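/- Let $G$ be a (discrete) group that is amenable, i.e. every action of $G$ by homeomorphisms on a non-empty compact Hausdorff space admits a $G$-invariant Borel probability measure, and assume that the integral group ring $\mathbb{Z}[G]$ is a domain (it has no zero divisors). Let $n\ge 0$ be an integer. Suppose that $G$ has cohomological dimension $n$, i.e. the shortest projective resolution of the trivial left $\mathbb{Z}[G]$-module $\mathbb{Z}$ has length $n$, and that $G$ is of type $FP_{n-1}$, i.e. there is a projective resolution $P_*$ of the trivial $\mathbb{Z}[G]$-module $\mathbb{Z}$ such that $P_d$ is finitely generated for all $0\le d\le n-1$ (no condition if $n=0$). Then $G$ is of type $FP$: the trivial $\mathbb{Z}[G]$-module $\mathbb{Z}$ has a projective resolution of finite length all of whose terms are finitely generated $\mathbb{Z}[G]$-modules. -/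

import Mathlib

open CategoryTheory

universe u

/-- A (discrete) group `G` is amenable if every action of `G` by homeomorphisms on a non-empty
compact Hausdorff space admits an invariant Borel probability measure. -/
def IsAmenableGroup (G : Type u) [Group G] : Prop :=
  ∀ (X : Type u) [TopologicalSpace X] [CompactSpace X] [T2Space X] [Nonempty X]
    [MeasurableSpace X] [BorelSpace X] [MulAction G X] [ContinuousConstSMul G X],
    ∃ μ : MeasureTheory.Measure X,
      MeasureTheory.IsProbabilityMeasure μ ∧ MeasureTheory.SMulInvariantMeasure G X μ

/-- The trivial left `ℤ[G]`-module `ℤ`, on which every `g : G` acts as the identity (lifted to the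
universe of `G`, so that it lies in the same category of modules as `ℤ[G]`). -/
noncomputable def trivialModule (G : Type u) [Group G] : ModuleCat.{u} (MonoidAlgebra ℤ G) :=
  ModuleCat.of (MonoidAlgebra ℤ G) (Representation.trivial ℤ G (ULift.{u} ℤ)).asModule

/-- The projective resolutions of the trivial module `ℤ` by left `ℤ[G]`-modules. -/
abbrev TrivialResolution (G : Type u) [Group G] :=
  ProjectiveResolution (trivialModule G)

/-- The resolution `⋯ → P₁ → P₀ → ℤ` has length at most `m`: `P_d = 0` for all `d > m`. -/
def TrivialResolution.LengthLE {G : Type u} [Group G] (P : TrivialResolution G) (m : ℕ) : Prop :=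
  ∀ d : ℕ, m < d → Subsingleton (P.complex.X d)

/-- The cohomological dimension of `G`: the length of the shortest projective resolution of the
trivial `ℤ[G]`-module `ℤ`, and `⊤` if there is no such resolution of finite length. -/
noncomputable def cohomologicalDimension (G : Type u) [Group G] : ℕ∞ :=
  sInf {l : ℕ∞ | ∃ m : ℕ, l = m ∧ ∃ P : TrivialResolution G, P.LengthLE m}

/-- `G` is of type `FP_k`: the trivial `ℤ[G]`-module `ℤ` has a projective resolution `P` with `P_d`
finitely generated for all `0 ≤ d ≤ k`. For negative `k` this is no condition on `G`. -/
def IsTypeFPUpTo (G : Type u) [Group G] (k : ℤ) : Prop :=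
  ∃ P : TrivialResolution G, ∀ d : ℕ, (d : ℤ) ≤ k → Module.Finite (MonoidAlgebra ℤ G) (P.complex.X d)

/-- `G` is of type `FP`: the trivial `ℤ[G]`-module `ℤ` has a projective resolution of finite length
all of whose terms are finitely generated. -/
def IsTypeFP (G : Type u) [Group G] : Prop :=
  ∃ P : TrivialResolution G, (∃ m : ℕ, P.LengthLE m) ∧
    ∀ d : ℕ, Module.Finite (MonoidAlgebra ℤ G) (P.complex.X d)

/-! Amenability enters only through the strong rank condition for `ℤ[G]`. An injection `ℤ[G]^n →
ℤ[G]^m` with `m < n`, restricted to tuples supported in a Følner set `F`, would embed `ℤ^(|F|n)` in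
a free abelian group of smaller rank (`IsAmenableGroup.strongRankCondition`). Over a domain with
this condition, a projective module inside a finitely generated one is finitely generated
(`Module.Finite.of_projective_of_injective`). In a resolution finitely generated below degree `n`,
the `n`-th syzygy is projective by dimension shifting; for `n > 0` it embeds in the term of degree
`n - 1`, and for `n = 0` it is `ℤ`. Either way it is finitely generated and closes off the
resolution. -/

open scoped Pointwise ENNReal

/-! ### Invariant means and Følner sets -/

/-- The right translation action of a group on its ultrafilters. -/
@[reducible]
def ultrafilterRightMulAction (G : Type u) [Group G] :
    MulAction G (Ultrafilter G) where
  smul g p := p.map (fun x => x * g⁻¹)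
  one_smul p := by
    change p.map _ = p
    simp
  mul_smul g h p := by
    change p.map _ = (p.map _).map _
    rw [Ultrafilter.map_map]
    congr 1
    funext x
    simp [mul_assoc]

/-- An amenable group carries a finitely additive probability measure, defined on all subsets and
invariant under right translations. -/
theorem IsAmenableGroup.exists_mean {G : Type u} [Group G] (hG : IsAmenableGroup G) :
    ∃ m : Set G → ℝ≥0∞, m Set.univ = 1 ∧ (∀ A, m A ≤ 1) ∧
      (∀ (ι : Type u) [Fintype ι] (A : ι → Set G), Pairwise (Function.onFun Disjoint A) →
        m (⋃ i, A i) = ∑ i, m (A i)) ∧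
      ∀ (g : G) (A : Set G), m ((fun x => x * g) ⁻¹' A) = m A := by
  let : MulAction G (Ultrafilter G) := ultrafilterRightMulAction G
  let : MeasurableSpace (Ultrafilter G) := borel _
  have : BorelSpace (Ultrafilter G) := ⟨rfl⟩
  have mem_smul (g : G) (p : Ultrafilter G) (A : Set G) :
      A ∈ g • p ↔ (fun x => x * g⁻¹) ⁻¹' A ∈ p := Iff.rfl
  have : ContinuousConstSMul G (Ultrafilter G) := ⟨fun g => by
    refine continuous_generateFrom_iff.2 ?_
    rintro _ ⟨A, rfl⟩
    exact ultrafilter_isOpen_basic ((fun x => x * g⁻¹) ⁻¹' A)⟩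
  obtain ⟨μ, hμ, hinv⟩ := hG (Ultrafilter G)
  have meas (A : Set G) : MeasurableSet {p : Ultrafilter G | A ∈ p} :=
    (ultrafilter_isOpen_basic A).measurableSet
  refine ⟨fun A => μ {p | A ∈ p}, ?_, fun A => MeasureTheory.prob_le_one, ?_, ?_⟩
  · have : {p : Ultrafilter G | Set.univ ∈ p} = Set.univ :=
      Set.eq_univ_of_forall fun _ => Filter.univ_mem
    simp only [this, MeasureTheory.measure_univ]
  · intro ι _ A hA
    -- An ultrafilter contains a finite union iff it contains one of the pieces.
    have h : {p : Ultrafilter G | (⋃ i, A i) ∈ p} = ⋃ i, {p : Ultrafilter G | A i ∈ p} := by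
      ext p
      have := Ultrafilter.finite_biUnion_mem_iff (f := p) (s := A) (Set.finite_univ (α := ι))
      simpa using this
    simp only [h]
    rw [MeasureTheory.measure_iUnion _ fun i => meas (A i), tsum_fintype]
    intro i j hij
    refine Set.disjoint_left.2 fun p hi hj => ?_
    have := Filter.inter_mem hi hj
    rw [(hA hij).inter_eq] at this
    exact p.empty_notMem this
  · intro g A
    have := hinv.measure_preimage_smul g⁻¹ (meas A)
    simpa [Set.preimage, mem_smul] using this

/-- If `G` carries an invariant mean, `n` copies of `G` cannot be injected with bounded displacement
into `m < n` copies of `G`. -/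
theorem IsAmenableGroup.le_of_injective {G : Type u} [Group G] (hG : IsAmenableGroup G)
    {n m : ℕ} (S : Finset G) (φ : G × Fin n → G × Fin m) (hφ : Function.Injective φ)
    (hS : ∀ x, x.1⁻¹ * (φ x).1 ∈ S) : n ≤ m := by
  obtain ⟨μ, h1, hle, hadd, hinv⟩ := hG.exists_mean
  -- For fixed `i` these sets partition `G`. For fixed `j` their right translates by `s` are
  -- disjoint, since `φ` is injective. Summing means both ways gives `n ≤ m`.
  let A (s : S) (i : Fin n) (j : Fin m) : Set G := {g | φ (g, i) = (g * s, j)}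
  have hrow (i : Fin n) : ∑ p : S × ULift.{u} (Fin m), μ (A p.1 i p.2.down) = 1 := by
    rw [← hadd (S × ULift.{u} (Fin m)) (fun p => A p.1 i p.2.down), ← h1]
    · congr 1
      refine Set.eq_univ_of_forall fun g => Set.mem_iUnion.2
        ⟨(⟨_, hS (g, i)⟩, ⟨(φ (g, i)).2⟩), ?_⟩
      simp [A]
    · rintro ⟨s, ⟨j⟩⟩ ⟨t, ⟨k⟩⟩ hne
      refine Set.disjoint_left.2 fun g hg hg' => hne ?_
      have := hg.symm.trans hg'
      simp only [Prod.mk.injEq, mul_right_inj] at this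
      ext <;> simp [this]
  have hcol (j : Fin m) : ∑ p : S × ULift.{u} (Fin n), μ (A p.1 p.2.down j) ≤ 1 := by
    have : ∀ p : S × ULift.{u} (Fin n), μ (A p.1 p.2.down j) =
        μ ((fun x => x * (p.1 : G)⁻¹) ⁻¹' A p.1 p.2.down j) := fun p => (hinv _ _).symm
    simp only [this]
    rw [← hadd (S × ULift.{u} (Fin n))
      (fun p => (fun x => x * (p.1 : G)⁻¹) ⁻¹' A p.1 p.2.down j)]
    · exact hle _
    · rintro ⟨s, ⟨i⟩⟩ ⟨t, ⟨k⟩⟩ hne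
      refine Set.disjoint_left.2 fun g hg hg' => hne ?_
      simp only [A, Set.mem_preimage, Set.mem_ofPred_eq, inv_mul_cancel_right] at hg hg'
      have := hφ (hg.trans hg'.symm)
      simp only [Prod.mk.injEq, mul_right_inj, inv_inj] at this
      ext <;> simp [this]
  have hn : ∑ i : Fin n, ∑ j : Fin m, ∑ s : S, μ (A s i j) = n := by
    have (i : Fin n) : ∑ j : Fin m, ∑ s : S, μ (A s i j) = 1 := by
      rw [← hrow i, Fintype.sum_prod_type, Finset.sum_comm]
      refine Finset.sum_congr rfl fun s _ => ?_
      exact (Equiv.ulift.sum_comp fun j => μ (A s i j)).symm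
    simp only [this, Finset.sum_const, Finset.card_univ, Fintype.card_fin, nsmul_one]
  have hm : ∑ j : Fin m, ∑ i : Fin n, ∑ s : S, μ (A s i j) ≤ m := by
    have (j : Fin m) : ∑ i : Fin n, ∑ s : S, μ (A s i j) ≤ 1 := by
      refine le_of_eq_of_le ?_ (hcol j)
      rw [Fintype.sum_prod_type, Finset.sum_comm]
      refine Finset.sum_congr rfl fun s _ => ?_
      exact (Equiv.ulift.sum_comp fun i => μ (A s i j)).symm
    simpa using Finset.sum_le_sum fun j (_ : j ∈ Finset.univ) => this j
  rw [Finset.sum_comm, hn] at hm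
  exact_mod_cast hm

/-- A Følner-type property of amenable groups. -/
theorem IsAmenableGroup.exists_card_mul_lt {G : Type u} [Group G] [DecidableEq G]
    (hG : IsAmenableGroup G) (S : Finset G) {n m : ℕ} (hmn : m < n) :
    ∃ F : Finset G, (F * S).card * m < F.card * n := by
  by_contra! h
  -- Hall's marriage theorem, with `(g, i)` allowed to go to any `(g * s, j)`: failure of the Følner
  -- inequality is Hall's condition, checked on the projection of `T` to `G`.
  have hall := (Finset.all_card_le_biUnion_card_iff_exists_injective
    (fun x : G × Fin n => ({x.1} * S) ×ˢ (Finset.univ : Finset (Fin m)))).1 fun T => by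
      calc T.card ≤ (T.image Prod.fst ×ˢ (Finset.univ : Finset (Fin n))).card :=
            Finset.card_le_card fun x hx => by
              simpa using ⟨x.2, hx⟩
        _ = (T.image Prod.fst).card * n := by simp
        _ ≤ (T.image Prod.fst * S).card * m := h _
        _ = ((T.image Prod.fst * S) ×ˢ (Finset.univ : Finset (Fin m))).card := by simp
        _ ≤ _ := Finset.card_le_card fun y hy => by
              simp only [Finset.mem_product, Finset.mem_univ, and_true, Finset.mem_mul,
                Finset.mem_image] at hy
              obtain ⟨_, ⟨x, hx, rfl⟩, s, hs, hy⟩ := hy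
              simp only [Finset.mem_biUnion, Finset.mem_product, Finset.mem_univ, and_true]
              exact ⟨x, hx, hy ▸ Finset.mul_mem_mul (Finset.mem_singleton_self _) hs⟩
  obtain ⟨φ, hφ, hmem⟩ := hall
  refine hmn.not_ge (hG.le_of_injective S φ hφ fun x => ?_)
  have := hmem x
  simp only [Finset.mem_product, Finset.mem_univ, and_true, Finset.mem_mul,
    Finset.mem_singleton, exists_eq_left] at this
  obtain ⟨s, hs, h⟩ := this
  simpa [← h] using hs

/-! ### Rank and finite generation -/

/-- The integral group ring of an amenable group satisfies the strong rank condition. -/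
theorem IsAmenableGroup.strongRankCondition {G : Type u} [Group G] (hG : IsAmenableGroup G) :
    StrongRankCondition (MonoidAlgebra ℤ G) := by
  classical
  refine ⟨fun {n m} f hf => ?_⟩
  by_contra! hmn
  -- The supports of all matrix entries of `f`, so that `f` maps tuples supported in `F` to tuples
  -- supported in `F * S`.
  let S : Finset G := Finset.univ.biUnion fun p : Fin n × Fin m =>
    (f (Pi.single p.1 1) p.2).coeff.support
  obtain ⟨F, hF⟩ := hG.exists_card_mul_lt S hmn
  let ι : (F × Fin n → ℤ) →ₗ[ℤ] (Fin n → MonoidAlgebra ℤ G) :=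
    { toFun c i := ∑ g : F, MonoidAlgebra.single (g : G) (c (g, i))
      map_add' c d := by
        funext i
        simp [Finset.sum_add_distrib]
      map_smul' r c := by
        funext i
        simp [Finset.smul_sum] }
  have hι_coeff (c : F × Fin n → ℤ) (i : Fin n) (g : F) : (ι c i).coeff g = c (g, i) := by
    simp [ι, MonoidAlgebra.coeff_sum, Finsupp.single_apply, Finsupp.finsetSum_apply]
  have hι_supp (c : F × Fin n → ℤ) (i : Fin n) : (ι c i).coeff.support ⊆ F := fun g hg => by
    by_contra hgF
    refine Finsupp.mem_support_iff.1 hg ?_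
    simp only [ι, LinearMap.coe_mk, AddHom.coe_mk, MonoidAlgebra.coeff_sum,
      Finsupp.finsetSum_apply]
    refine Finset.sum_eq_zero fun x _ => ?_
    have : (x : G) ≠ g := fun h => hgF (h ▸ x.2)
    simp [this]
  have hf_eq (x : Fin n → MonoidAlgebra ℤ G) (j : Fin m) :
      f x j = ∑ i, x i * f (Pi.single i 1) j := by
    conv_lhs => rw [← Finset.univ_sum_single x]
    rw [map_sum, Finset.sum_apply]
    refine Finset.sum_congr rfl fun i _ => ?_
    have : Pi.single i (x i) = x i • (Pi.single i 1 : Fin n → MonoidAlgebra ℤ G) := by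
      rw [← Pi.single_smul]
      simp
    rw [this, map_smul]
    rfl
  have hf_supp (c : F × Fin n → ℤ) (j : Fin m) : (f (ι c) j).coeff.support ⊆ F * S := by
    rw [hf_eq, MonoidAlgebra.coeff_sum]
    refine Finsupp.support_finsetSum.trans (Finset.biUnion_subset.2 fun i _ => ?_)
    refine (MonoidAlgebra.support_coeff_mul_subset _ _).trans
      (Finset.mul_subset_mul (hι_supp c i) ?_)
    exact Finset.subset_biUnion_of_mem
      (fun p : Fin n × Fin m => (f (Pi.single p.1 1) p.2).coeff.support) (Finset.mem_univ (i, j))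
  let L : (F × Fin n → ℤ) →ₗ[ℤ] ((F * S : Finset G) × Fin m → ℤ) :=
    { toFun c p := (f (ι c) p.2).coeff p.1
      map_add' c d := by
        funext p
        simp
      map_smul' r c := by
        funext p
        rw [map_smul, LinearMap.map_smul_of_tower, Pi.smul_apply, MonoidAlgebra.coeff_smul]
        rfl }
  have hL : Function.Injective L := by
    refine (injective_iff_map_eq_zero L).2 fun c hc => ?_
    have h0 : f (ι c) = 0 := by
      funext j
      ext g
      by_contra hg
      have hmem := hf_supp c j (Finsupp.mem_support_iff.2 hg)
      exact hg (congr_fun hc (⟨g, hmem⟩, j))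
    have h1 : ι c = 0 := hf (by rw [h0, map_zero])
    funext p
    rw [← hι_coeff c p.2 p.1, h1]
    rfl
  have := card_le_of_injective ℤ L hL
  simp only [Fintype.card_prod, Fintype.card_coe, Fintype.card_fin] at this
  omega

/-- Over a domain with the strong rank condition, a projective module that embeds into a finitely
generated module is finitely generated. -/
theorem Module.Finite.of_projective_of_injective {R K P : Type*} [Ring R] [IsDomain R]
    [StrongRankCondition R] [AddCommGroup K] [Module R K] [AddCommGroup P] [Module R P]
    [Module.Finite R P] [Module.Projective R K] (f : K →ₗ[R] P) (hf : Function.Injective f) :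
    Module.Finite R K := by
  classical
  obtain ⟨s, hs⟩ := Module.projective_def'.1 (inferInstance : Module.Projective R K)
  obtain ⟨B, hB, hmax⟩ := exists_maximal_linearIndepOn R (id : K → K)
  have hfin : Finite B :=
    LinearIndependent.finite (LinearIndependent.map' hB f (LinearMap.ker_eq_bot.2 hf))
  have hBfin : B.Finite := Set.toFinite B
  let J : Finset K := hBfin.toFinset.biUnion fun k => (s k).support
  have hspan : Submodule.span R B ≤ (Finsupp.supported R R (J : Set K)).comap s := by
    refine Submodule.span_le.2 fun k hk => ?_
    refine (Finsupp.mem_supported R _).2 (Finset.coe_subset.2 ?_)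
    exact Finset.subset_biUnion_of_mem (fun k => (s k).support) (hBfin.mem_toFinset.2 hk)
  -- By maximality of `B`, some nonzero multiple of `k` lies in its span; in a domain this multiple
  -- does not shrink the support of `s k`.
  have hsupp (k : K) : s k ∈ Finsupp.supported R R (J : Set K) := by
    by_cases hk : k ∈ B
    · exact hspan (Submodule.subset_span hk)
    · obtain ⟨a, ha, hak⟩ := hmax k hk
      have := hspan (by simpa using hak)
      rw [Submodule.mem_comap, map_smul, Finsupp.mem_supported] at this
      rwa [Finsupp.mem_supported, ← Finsupp.support_smul_eq ha]
  refine ⟨⟨J, eq_top_iff.2 fun k _ => ?_⟩⟩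
  have hk : Finsupp.linearCombination R id (s k) = k := LinearMap.congr_fun hs k
  have := (Finsupp.mem_span_image_iff_linearCombination R (v := (id : K → K))).2
    ⟨s k, hsupp k, hk⟩
  simpa using this

/-! ### Truncating and splicing projective resolutions -/

namespace CategoryTheory

open Limits

variable {C : Type*} [Category* C] [Abelian C]

lemma ShortComplex.exact_comp_mono_iff {X Y Z W : C} (f : X ⟶ Y) (g : Y ⟶ Z) (i : Z ⟶ W) [Mono i]
    (w : f ≫ g = 0) (w' : f ≫ g ≫ i = 0) :
    (ShortComplex.mk f g w).Exact ↔ (ShortComplex.mk f (g ≫ i) w').Exact :=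
  ShortComplex.exact_iff_of_epi_of_isIso_of_mono
    { τ₁ := 𝟙 _, τ₂ := 𝟙 _, τ₃ := i : ShortComplex.mk f g w ⟶ ShortComplex.mk f (g ≫ i) w' }

lemma ShortComplex.exact_epi_comp_iff {X Y Z W : C} (e : X ⟶ Y) (f : Y ⟶ Z) (g : Z ⟶ W) [Epi e]
    (w : f ≫ g = 0) (w' : (e ≫ f) ≫ g = 0) :
    (ShortComplex.mk (e ≫ f) g w').Exact ↔ (ShortComplex.mk f g w).Exact :=
  ShortComplex.exact_iff_of_epi_of_isIso_of_mono
    { τ₁ := e, τ₂ := 𝟙 _, τ₃ := 𝟙 _ : ShortComplex.mk (e ≫ f) g w' ⟶ ShortComplex.mk f g w }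

namespace ProjectiveResolution

/-- The augmentation of a projective resolution. -/
noncomputable def augmentation {Z : C} (P : ProjectiveResolution Z) : P.complex.X 0 ⟶ Z :=
  P.π.f 0

instance {Z : C} (P : ProjectiveResolution Z) : Epi P.augmentation :=
  inferInstanceAs (Epi (P.π.f 0))

@[simp]
lemma d_comp_augmentation {Z : C} (P : ProjectiveResolution Z) :
    P.complex.d 1 0 ≫ P.augmentation = 0 :=
  P.complex_d_comp_π_f_zero

lemma exact_zero {Z : C} (P : ProjectiveResolution Z) :
    (ShortComplex.mk _ _ P.d_comp_augmentation).Exact :=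
  ShortComplex.exact_of_g_is_cokernel _ P.isColimitCokernelCofork

/-- The short exact sequence formed by the augmentation of a projective resolution. -/
noncomputable abbrev augmentationSequence {Z : C} (P : ProjectiveResolution Z) : ShortComplex C :=
  ShortComplex.mk (kernel.ι P.augmentation) P.augmentation (kernel.condition _)

lemma augmentationSequence_shortExact {Z : C} (P : ProjectiveResolution Z) :
    P.augmentationSequence.ShortExact where
  exact := ShortComplex.exact_kernel _

/-- A projective resolution is built from a complex of projectives, exact in positive degrees, and
a cokernel of its last differential. -/
noncomputable def ofExact {Z : C} (K : ChainComplex C ℕ) (hK : ∀ n, Projective (K.X n))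
    (p : K.X 0 ⟶ Z) (w : K.d 1 0 ≫ p = 0) [Epi p] (h₀ : (ShortComplex.mk _ _ w).Exact)
    (h : ∀ n, (ShortComplex.mk _ _ (K.d_comp_d (n + 2) (n + 1) n)).Exact) :
    ProjectiveResolution Z where
  complex := K
  projective := hK
  π := (ChainComplex.toSingle₀Equiv _ _).symm ⟨p, w⟩
  quasiIso := ⟨fun n => by
    cases n with
    | zero =>
      rw [ChainComplex.quasiIsoAt₀_iff, ShortComplex.quasiIso_iff_of_zeros']
      · refine (ShortComplex.exact_and_epi_g_iff_of_iso ?_).2 ⟨h₀, ‹Epi p›⟩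
        exact ShortComplex.isoMk (Iso.refl _) (Iso.refl _) (Iso.refl _)
          ((Category.id_comp _).trans (Category.comp_id _).symm)
          ((Category.id_comp p).trans
            ((ChainComplex.toSingle₀Equiv_symm_apply_f_zero p w).symm.trans
              (Category.comp_id (((ChainComplex.toSingle₀Equiv K Z).symm ⟨p, w⟩).f 0)).symm))
      · exact K.shape 0 0 (by simp)
      all_goals rfl
    | succ n =>
      rw [quasiIsoAt_iff_exactAt']
      · exact (HomologicalComplex.exactAt_iff' _ (n + 2) (n + 1) n (by simp) (by simp)).2 (h n)
      · apply ChainComplex.exactAt_succ_single_obj⟩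

/-- Deleting the last term of a projective resolution yields a projective resolution of the
kernel of the augmentation. -/
noncomputable def truncate {Z : C} (P : ProjectiveResolution Z) :
    ProjectiveResolution (kernel P.augmentation) :=
  have w : P.complex.d 2 1 ≫
      kernel.lift P.augmentation (P.complex.d 1 0) P.d_comp_augmentation = 0 := by
    rw [← cancel_mono (kernel.ι _), Category.assoc, kernel.lift_ι, P.complex.d_comp_d, zero_comp]
  have : Epi (show (ChainComplex.truncate.obj P.complex).X 0 ⟶ kernel P.augmentation from
      kernel.lift P.augmentation (P.complex.d 1 0) P.d_comp_augmentation) :=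
    P.exact_zero.epi_kernelLift
  ofExact (ChainComplex.truncate.obj P.complex) (fun n => P.projective (n + 1))
    (kernel.lift P.augmentation (P.complex.d 1 0) P.d_comp_augmentation) w
    ((ShortComplex.exact_comp_mono_iff _ _ (kernel.ι P.augmentation) w (by
      rw [kernel.lift_ι]; exact P.complex.d_comp_d 2 1 0)).2 (by
        simp only [kernel.lift_ι]; exact P.exact_succ 0))
    (fun n => P.exact_succ (n + 1))

/-- Splicing a projective resolution of the kernel of an epimorphism from a projective object. -/
noncomputable def splice {P Z : C} [Projective P] (p : P ⟶ Z) [Epi p]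
    (Q : ProjectiveResolution (kernel p)) : ProjectiveResolution Z :=
  have w : Q.complex.d 1 0 ≫ Q.augmentation ≫ kernel.ι p = 0 := by
    rw [← Category.assoc, Q.d_comp_augmentation, zero_comp]
  have w' : (Q.augmentation ≫ kernel.ι p) ≫ p = 0 := by simp
  have : Epi (show (ChainComplex.augment Q.complex _ w).X 0 ⟶ Z from p) := ‹Epi p›
  ofExact (ChainComplex.augment Q.complex (Q.augmentation ≫ kernel.ι p) w)
    (fun n => match n with
      | 0 => ‹Projective P›
      | n + 1 => Q.projective n)
    p w'
    ((ShortComplex.exact_epi_comp_iff Q.augmentation (kernel.ι p) p (kernel.condition p) w').2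
      (ShortComplex.exact_kernel p))
    (fun n => match n with
      | 0 => (ShortComplex.exact_comp_mono_iff _ _ (kernel.ι p) Q.d_comp_augmentation w).1
          Q.exact_zero
      | n + 1 => Q.exact_succ n)

lemma hasProjectiveDimensionLE_of_isZero {Z : C} (P : ProjectiveResolution Z) (n : ℕ)
    (hP : ∀ d, n < d → IsZero (P.complex.X d)) : HasProjectiveDimensionLE Z n := by
  induction n generalizing Z with
  | zero =>
    have : IsZero (kernel P.augmentation) :=
      IsZero.of_epi P.truncate.augmentation (hP 1 one_pos)
    exact P.augmentationSequence_shortExact.hasProjectiveDimensionLT_X₃ 0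
      this.hasProjectiveDimensionLT_zero
      (inferInstanceAs (HasProjectiveDimensionLT (P.complex.X 0) 1))
  | succ n ih =>
    exact P.augmentationSequence_shortExact.hasProjectiveDimensionLT_X₃ (n + 1)
      (ih P.truncate fun d hd => hP (d + 1) (by lia))
      (hasProjectiveDimensionLT_of_ge (P.complex.X 0) 1 _ (by lia))

/-- Dimension shifting, in place of Schanuel's lemma: the bound depends on `Z` alone, so it passes
from a short resolution to the finitely generated one. -/
lemma hasProjectiveDimensionLE_kernel_augmentation {Z : C} (P : ProjectiveResolution Z) (n : ℕ)
    [h : HasProjectiveDimensionLE Z (n + 1)] :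
    HasProjectiveDimensionLE (kernel P.augmentation) n :=
  (P.augmentationSequence_shortExact.hasProjectiveDimensionLT_X₃_iff n (P.projective 0)).1 h

end ProjectiveResolution

/-- Suppose that projective modules which embed into finitely generated modules are finitely
generated. If a module has projective dimension at most `n` and a projective resolution which is
finitely generated in degrees below `n`, then it has a finite resolution by finitely generated
projective modules. -/
theorem ProjectiveResolution.exists_finite {R : Type u} [Ring R] [IsDomain R]
    [StrongRankCondition R] (n : ℕ) {Z : ModuleCat.{u} R} [HasProjectiveDimensionLE Z n]
    (hZ : Projective Z → Module.Finite R Z) (P : ProjectiveResolution Z)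
    (hP : ∀ d < n, Module.Finite R (P.complex.X d)) :
    ∃ Q : ProjectiveResolution Z, (∀ d, n < d → Subsingleton (Q.complex.X d)) ∧
      ∀ d, Module.Finite R (Q.complex.X d) := by
  induction n generalizing Z with
  | zero =>
    have : Projective Z := projective_iff_hasProjectiveDimensionLE_zero _ |>.2 inferInstance
    have hsub (d : ℕ) : Subsingleton ((ProjectiveResolution.self Z).complex.X (d + 1)) :=
      ModuleCat.subsingleton_of_isZero (HomologicalComplex.isZero_single_obj_X _ _ _ _ (by simp))
    refine ⟨ProjectiveResolution.self Z, fun d hd => ?_, fun d => ?_⟩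
    · obtain ⟨d, rfl⟩ := Nat.exists_eq_succ_of_ne_zero hd.ne'
      exact hsub d
    · cases d with
      | zero => exact hZ this
      | succ d =>
        have := hsub d
        infer_instance
  | succ n ih =>
    have := P.hasProjectiveDimensionLE_kernel_augmentation n
    have hfin : Module.Finite R (P.complex.X 0) := hP 0 n.succ_pos
    -- If the kernel is projective, it is finitely generated because it embeds in degree `0` of `P`.
    obtain ⟨Q, hQ, hQfin⟩ := ih (Z := Limits.kernel P.augmentation) (fun h => by
      have := (Limits.kernel P.augmentation).projective_of_categoryTheory_projective
      exact Module.Finite.of_projective_of_injective (Limits.kernel.ι P.augmentation).hom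
        ((ModuleCat.mono_iff_injective _).1 inferInstance)) P.truncate
        (fun d hd => hP (d + 1) (by lia))
    refine ⟨ProjectiveResolution.splice P.augmentation Q, fun d hd => ?_, fun d => ?_⟩
    · obtain ⟨d, rfl⟩ := Nat.exists_eq_succ_of_ne_zero (by lia : d ≠ 0)
      exact hQ d (by lia)
    · cases d with
      | zero => exact hfin
      | succ d => exact hQfin d

end CategoryTheory

/-! ### The trivial module and the conclusion -/

instance trivialModule_finite (G : Type u) [Group G] :
    Module.Finite (MonoidAlgebra ℤ G) (trivialModule G) := by
  have : Module.Finite ℤ (trivialModule G) :=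
    inferInstanceAs (Module.Finite ℤ (ULift.{u} ℤ))
  exact Module.Finite.of_restrictScalars_finite ℤ _ _

lemma exists_lengthLE_of_cohomologicalDimension_eq {G : Type u} [Group G] {n : ℕ}
    (h : cohomologicalDimension G = n) : ∃ P : TrivialResolution G, P.LengthLE n := by
  -- The infimum of the empty set is `⊤`, so a finite value is attained.
  have hne : {l : ℕ∞ | ∃ m : ℕ, l = m ∧ ∃ P : TrivialResolution G, P.LengthLE m}.Nonempty := by
    by_contra hempty
    rw [cohomologicalDimension, Set.not_nonempty_iff_eq_empty.1 hempty, sInf_empty] at h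
    exact ENat.top_ne_natCast n h
  obtain ⟨m, hm, P, hP⟩ := csInf_mem hne
  rw [cohomologicalDimension, hm, Nat.cast_inj] at h
  exact ⟨P, h ▸ hP⟩

theorem theoremA {G : Type u} [Group G] (hG : IsAmenableGroup G)
    (hdom : IsDomain (MonoidAlgebra ℤ G)) (n : ℕ)
    (hcd : cohomologicalDimension G = n) (hFP : IsTypeFPUpTo G ((n : ℤ) - 1)) :
    IsTypeFP G := by
  have := hG.strongRankCondition
  obtain ⟨P, hP⟩ := exists_lengthLE_of_cohomologicalDimension_eq hcd
  obtain ⟨Q, hQ⟩ := hFP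
  have : HasProjectiveDimensionLE (trivialModule G) n :=
    P.hasProjectiveDimensionLE_of_isZero n fun d hd => by
      have := hP d hd
      exact ModuleCat.isZero_of_subsingleton _
  obtain ⟨R, hR, hRfin⟩ := ProjectiveResolution.exists_finite n (fun _ => trivialModule_finite G) Q
    fun d hd => hQ d (by lia)
  exact ⟨R, ⟨n, hR⟩, hRfin⟩
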